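/- Let $S$ be an integral scheme. "Of finite presentation" means locally of finite presentation, quasi-compact and quasi-separated. For a morphism $f : T \to S$, let $\mathsf E(T/S)$ be the category whose objects are the factorizations $T \xrightarrow{h} E \xrightarrow{g} S$ of $f$ with $h$ surjective and $g$ étale and separated; a morphism $(E,h,g) \to (E',h',g')$ is a morphism $u : E \to E'$ with $uh = h'$ and $g'u = g$. (1) If $f : T \to S$ is faithfully flat and of finite presentation, then $\mathsf E(T/S)$ has an initial object $T \to \pi^s(T/S) \to S$. (2) The construction $T \mapsto \pi^s(T/S)$ is functorial in $T$, and this functor is left adjoint to the inclusion of the étale separated $S$-schemes into the category of faithfully flat $S$-schemes of finite presentation. More precisely, let $\mathsf F$ be the category of faithfully flat $S$-schemes of finite presentation (with all $S$-morphisms), and $\mathsf F^{\text{ét,sep}}$ its full subcategory of étale separated $S$-schemes. There is a functor $\pi^s : \mathsf F \to \mathsf F^{\text{ét,sep}}$, left adjoint to the inclusion $\mathsf F^{\text{ét,sep}} \subset \mathsf F$, such that for every $T$ in $\mathsf F$ the unit $T \to \pi^s(T)$ makes $T \to \pi^s(T) \to S$ an initial object of $\mathsf E(T/S)$. Moreover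 every $S$-morphism from $T$ to an arbitrary étale separated $S$-scheme $E$ (not assumed quasi-compact or surjective over $S$) factors through the unit $T \to \pi^s(T)$ by a unique $S$-morphism $\pi^s(T) \to E$. (3) Statement (2) also holds, in all its parts, when $\mathsf F$ is replaced by the category of all flat $S$-schemes of finite presentation. -/

import Mathlib

open CategoryTheory CategoryTheory.Limits AlgebraicGeometry

universe u

namespace SepEtale

/-- Morphisms of finite presentation: locally of finite presentation, quasi-compact and
quasi-separated. -/
def IsFinitelyPresented {X Y : Scheme.{u}} (f : X ⟶ Y) : Prop :=
  LocallyOfFinitePresentation f ∧ QuasiCompact f ∧ QuasiSeparated f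

/-- Étale and separated morphisms. -/
def IsEtaleSeparated {X Y : Scheme.{u}} (f : X ⟶ Y) : Prop :=
  AlgebraicGeometry.Etale f ∧ IsSeparated f

/-- The factorizations `T ⟶ E ⟶ S` of `f : T ⟶ S` with `T ⟶ E` surjective and `E ⟶ S` étale and
separated. -/
def isSepEtaleFactorisation {T S : Scheme.{u}} (f : T ⟶ S) : ObjectProperty (Factorisation f) :=
  fun F => Surjective F.ι ∧ IsEtaleSeparated F.π

/-- The category `E(T/S)` of factorizations `T ⟶ E ⟶ S` of `f`, with `T ⟶ E` surjective and
`E ⟶ S` étale and separated; a morphism is a morphism `E ⟶ E'` compatible with both the maps from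
`T` and the maps to `S`. -/
abbrev SepEtaleFactorisation {T S : Scheme.{u}} (f : T ⟶ S) :=
  (isSepEtaleFactorisation f).FullSubcategory

/-- The `S`-schemes that are flat and of finite presentation over `S`. -/
def flatFP (S : Scheme.{u}) : ObjectProperty (Over S) :=
  fun T => Flat T.hom ∧ IsFinitelyPresented T.hom

/-- The `S`-schemes that are faithfully flat and of finite presentation over `S`. -/
def faithfullyFlatFP (S : Scheme.{u}) : ObjectProperty (Over S) :=
  fun T => Flat T.hom ∧ Surjective T.hom ∧ IsFinitelyPresented T.hom

/-- The `S`-schemes that are étale and separated over `S`. -/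
def etaleSeparated (S : Scheme.{u}) : ObjectProperty (Over S) :=
  fun E => IsEtaleSeparated E.hom

/-- For a full subcategory `P` of the category of `S`-schemes, the inclusion into `P` of its full
subcategory of étale separated `S`-schemes. -/
abbrev inclusion {S : Scheme.{u}} (P : ObjectProperty (Over S)) :
    (etaleSeparated S ⊓ P).FullSubcategory ⥤ P.FullSubcategory :=
  ObjectProperty.ιOfLE (inf_le_right : etaleSeparated S ⊓ P ≤ P)

/-- The factorization `T ⟶ E ⟶ S` of the structure morphism of `T` given by a morphism of
`S`-schemes `T ⟶ E`. -/
def factorisationOfHom {S : Scheme.{u}} {T E : Over S} (h : T ⟶ E) : Factorisation T.hom where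
  mid := E.left
  ι := h.left
  π := E.hom
  ι_π := Over.w h

/-- The morphism of `S`-schemes `h : T ⟶ E` makes `T ⟶ E ⟶ S` an initial object of `E(T/S)`
(in particular, an object of it). -/
def IsInitialFactorisation {S : Scheme.{u}} {T E : Over S} (h : T ⟶ E) : Prop :=
  ∃ hh : isSepEtaleFactorisation T.hom (factorisationOfHom h),
    Nonempty (IsInitial (⟨factorisationOfHom h, hh⟩ : SepEtaleFactorisation T.hom))

/-- The morphism of `S`-schemes `h : T ⟶ E` is universal among the morphisms of `S`-schemes from `T`
to an étale separated `S`-scheme. -/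
def IsUniversalToEtaleSeparated {S : Scheme.{u}} {T E : Over S} (h : T ⟶ E) : Prop :=
  ∀ (E' : Over S), etaleSeparated S E' → ∀ φ : T ⟶ E', ∃! ψ : E ⟶ E', h ≫ ψ = φ

end SepEtale

/-! A factorization `T ⟶ E ⟶ S` is governed by its coincidence set `T ×[E] T ⊆ T ×[S] T`, closed
because `E` is separated over `S`. The generic fibre of `T ×[S] T` is a Noetherian space, so some
factorization `F` has a minimal trace there. Given any étale separated `E` under `T`, the open image
`G` of `T` in `F ×[S] E` is a factorization over `F`. Minimality gives `G` and `F` the same generic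
trace, so `G ⟶ F` is an isomorphism (`isIso_of_coincidence_subset`) and `F` maps to `E`. Uniqueness
is `hom_ext_of_surjective`; the adjunction is then formal. -/

namespace SepEtale

/-! ### Coincidence sets and their generic traces -/

section Coincidence

variable {T S : Scheme.{u}} {f : T ⟶ S}

/-- The morphism `T ×[S] T ⟶ E ×[S] E` induced by a factorization `T ⟶ E ⟶ S`. -/
noncomputable abbrev squareMap (F : Factorisation f) : pullback f f ⟶ pullback F.π F.π :=
  pullback.map f f F.π F.π F.ι F.ι (𝟙 S) (by simp) (by simp)

/-- The points of `T ×[S] T` whose two projections agree in `E`, for a factorization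
`T ⟶ E ⟶ S`. -/
def coincidence (F : Factorisation f) : Set ↑(pullback f f) :=
  squareMap F ⁻¹' Set.range (pullback.diagonal F.π)

lemma isClosed_coincidence (F : Factorisation f) [IsSeparated F.π] :
    IsClosed (coincidence F) :=
  (pullback.diagonal F.π).isClosedEmbedding.isClosed_range.preimage (squareMap F).continuous

lemma coincidence_mono {F G : Factorisation f} (u : F ⟶ G) : coincidence F ⊆ coincidence G := by
  rintro x ⟨e, he⟩
  have h₁ : squareMap G = squareMap F ≫ pullback.map F.π F.π G.π G.π u.h u.h (𝟙 S)
      (by simp) (by simp) := by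
    ext <;> simp [pullback.map, pullback.lift_fst, pullback.lift_snd, pullback.lift_fst_assoc,
      pullback.lift_snd_assoc]
  have h₂ : pullback.diagonal F.π ≫ pullback.map F.π F.π G.π G.π u.h u.h (𝟙 S)
      (by simp) (by simp) = u.h ≫ pullback.diagonal G.π := by
    ext <;> simp [pullback.map, pullback.lift_fst, pullback.lift_snd]
  refine ⟨u.h e, ?_⟩
  rw [h₁, Scheme.Hom.comp_apply, ← he, ← Scheme.Hom.comp_apply, ← Scheme.Hom.comp_apply, h₂]

lemma surjective_squareMap (F : Factorisation f) [Surjective F.ι] :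
    Surjective (squareMap F) := by
  have : MorphismProperty.IsStableUnderComposition @Surjective.{u} :=
    MorphismProperty.IsMultiplicative.toIsStableUnderComposition
  exact MorphismProperty.pullbackMap (P := @Surjective.{u}) ‹Surjective F.ι› ‹Surjective F.ι›
    F.ι_π.symm F.ι_π.symm

/-- A nonempty open image in `S` contains the generic point. -/
lemma genericPoint_mem_image [IrreducibleSpace S] {X : Scheme.{u}} (g : X ⟶ S)
    [UniversallyOpen g] {U : Set X} (hU : IsOpen U) (hne : U.Nonempty) :
    ∃ x ∈ U, g x = genericPoint S :=
  ((genericPoint_spec S).mem_open_set_iff (g.isOpenMap U hU)).mpr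
    (by simpa using hne.image g)

/-- If the coincidence sets of two factorizations agree over the generic point, then a surjective
morphism between the factorizations is an isomorphism. -/
lemma isIso_of_coincidence_subset [IrreducibleSpace S] {F G : Factorisation f}
    [Surjective F.ι] [Surjective G.ι] [Etale F.π] [IsSeparated F.π] [Etale G.π]
    (u : F ⟶ G)
    (hu : ∀ x : ↑(pullback f f), (pullback.fst f f ≫ f) x = genericPoint S →
      x ∈ coincidence G → x ∈ coincidence F) : IsIso u.h := by
  obtain ⟨E, h, g, hg⟩ := F
  obtain ⟨E', h', g', hg'⟩ := G
  obtain ⟨v, hv, hvπ⟩ := u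
  dsimp only at v hv hvπ ⊢
  subst hvπ
  dsimp only at *
  have : Etale v := MorphismProperty.of_postcomp @Etale v g' ‹_› ‹_›
  have : IsSeparated v := IsSeparated.of_comp v g'
  have : Surjective (h ≫ v) := hv ▸ ‹_›
  have : Surjective v := .of_comp h v
  -- The embedding of `E ×[E'] E` in `E ×[S] E`, where coincidence sets are measured.
  let i := pullback.mapDesc v v g'
  have hdi : pullback.diagonal v ≫ i = pullback.diagonal (v ≫ g') := by
    ext <;> simp [i, pullback.lift_fst, pullback.lift_snd]
  have hsurj : Surjective (pullback.diagonal v) := by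
    by_contra hns
    have hne : (Set.range (pullback.diagonal v))ᶜ.Nonempty := by
      rw [Set.nonempty_compl]
      exact fun h ↦ hns ⟨Set.range_eq_univ.mp h⟩
    -- The complement of the diagonal is open as `v` is separated, so it would have a point over the
    -- generic point.
    obtain ⟨y, hy, hyη⟩ := genericPoint_mem_image (pullback.fst v v ≫ v ≫ g')
      (pullback.diagonal v).isClosedEmbedding.isClosed_range.isOpen_compl hne
    have : Surjective (Factorisation.mk E h (v ≫ g') hg).ι := ‹Surjective h›
    obtain ⟨x, hx⟩ := (surjective_squareMap (Factorisation.mk E h (v ≫ g') hg)).surj (i y)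
    refine hy ?_
    have := hu x ?_ ?_
    · obtain ⟨e, he⟩ := this
      refine ⟨e, i.isEmbedding.injective ?_⟩
      rw [← Scheme.Hom.comp_apply, hdi, ← hx]
      exact he
    · have h₁ : pullback.fst f f ≫ f = squareMap (Factorisation.mk E h (v ≫ g') hg) ≫
          pullback.fst (v ≫ g') (v ≫ g') ≫ v ≫ g' := by
        simp [hg, pullback.lift_fst_assoc]
      have h₂ : i ≫ pullback.fst (v ≫ g') (v ≫ g') ≫ v ≫ g' = pullback.fst v v ≫ v ≫ g' := by
        simp [i, pullback.lift_fst_assoc]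
      rw [h₁, Scheme.Hom.comp_apply, hx, ← Scheme.Hom.comp_apply, h₂, hyη]
    · refine ⟨(pullback.fst v v ≫ v) y, ?_⟩
      have h₁ : squareMap (Factorisation.mk E' h' g' hg') =
          squareMap (Factorisation.mk E h (v ≫ g') hg) ≫
          pullback.map (v ≫ g') (v ≫ g') g' g' v v (𝟙 S) (by simp) (by simp) := by
        ext <;> simp [hv, pullback.map, pullback.lift_fst, pullback.lift_snd,
          pullback.lift_fst_assoc, pullback.lift_snd_assoc]
      have h₂ : (pullback.fst v v ≫ v) ≫ pullback.diagonal g' =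
          i ≫ pullback.map (v ≫ g') (v ≫ g') g' g' v v (𝟙 S) (by simp) (by simp) := by
        apply pullback.hom_ext
        · simp [i, pullback.map, pullback.lift_fst, pullback.lift_fst_assoc]
        · simp [i, pullback.map, pullback.lift_snd, pullback.lift_snd_assoc, pullback.condition]
      rw [h₁, Scheme.Hom.comp_apply (squareMap _), hx, ← Scheme.Hom.comp_apply i, ← h₂]
      rfl
  -- The diagonal of an étale morphism is an open immersion; an étale monomorphism is one too.
  have : IsIso (pullback.diagonal v) := (isIso_iff_isOpenImmersion_and_surjective _).mpr
    ⟨inferInstance, inferInstance⟩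
  have : Mono v := (pullback.isIso_diagonal_iff v).mp this
  have : IsOpenImmersion v := IsOpenImmersion.of_flat_of_mono v
  exact (isIso_iff_isOpenImmersion_and_surjective _).mpr ⟨inferInstance, inferInstance⟩

end Coincidence

/-! ### Morphisms to étale schemes -/

section Morphisms

variable {T S : Scheme.{u}}

/-- A morphism to an étale scheme over `S` is universally open if its composite with the
structure morphism is. -/
lemma universallyOpen_of_comp {E : Scheme.{u}} (h : T ⟶ E) (g : E ⟶ S) [Etale g]
    [UniversallyOpen (h ≫ g)] : UniversallyOpen h := by
  have : MorphismProperty.HasOfPostcompProperty @UniversallyOpen @Etale :=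
    MorphismProperty.hasOfPostcompProperty_iff_le_diagonal.mpr fun _ _ f hf ↦ by
      have : Etale f := hf
      change UniversallyOpen (pullback.diagonal f)
      infer_instance
  exact MorphismProperty.of_postcomp (W := @UniversallyOpen) (W' := @Etale) h g ‹_› ‹_›

/-- Two morphisms over `S` to an étale `S`-scheme agree if they agree after composing
with a surjective morphism. -/
lemma hom_ext_of_surjective {E E' : Scheme.{u}} (h : T ⟶ E) [Surjective h] {g : E ⟶ S}
    {g' : E' ⟶ S} [Etale g'] {u v : E ⟶ E'} (hu : u ≫ g' = g) (hv : v ≫ g' = g)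
    (huv : h ≫ u = h ≫ v) : u = v := by
  let w : E ⟶ pullback g' g' := pullback.lift u v (by rw [hu, hv])
  -- `d` is the equalizer of `u` and `v`: an open immersion, surjective because `h` factors through
  -- it.
  let d := pullback.snd (pullback.diagonal g') w
  let l : T ⟶ pullback (pullback.diagonal g') w :=
    pullback.lift (h ≫ u) h <| by
      apply pullback.hom_ext <;> simp [w, huv, pullback.lift_fst, pullback.lift_snd]
  have hl : l ≫ d = h := pullback.lift_snd _ _ _
  have : Surjective (l ≫ d) := by rwa [hl]
  have : Surjective d := .of_comp l d
  have : IsIso d := (isIso_iff_isOpenImmersion_and_surjective _).mpr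
    ⟨inferInstance, inferInstance⟩
  rw [← cancel_epi d]
  have hc : pullback.fst (pullback.diagonal g') w ≫ pullback.diagonal g' = d ≫ w :=
    pullback.condition
  have h₁ := congr($hc ≫ pullback.fst g' g')
  have h₂ := congr($hc ≫ pullback.snd g' g')
  simp only [Category.assoc, pullback.diagonal_fst, pullback.diagonal_snd, w,
    pullback.lift_fst, pullback.lift_snd] at h₁ h₂
  exact h₁.symm.trans h₂

lemma quasiCompact_of_comp_surjective {E : Scheme.{u}} (h : T ⟶ E) (g : E ⟶ S) [Surjective h]
    [QuasiCompact (h ≫ g)] : QuasiCompact g := by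
  refine ⟨fun U hU hU' ↦ ?_⟩
  have := (QuasiCompact.isCompact_preimage (f := h ≫ g) U hU hU').image h.continuous
  rwa [Scheme.Hom.comp_base, TopCat.coe_comp, Set.preimage_comp,
    Set.image_preimage_eq _ h.surjective] at this

lemma exists_surjective_open_factor {E : Scheme.{u}} (h : T ⟶ E) [UniversallyOpen h] :
    ∃ (U : E.Opens) (h' : T ⟶ U), Surjective h' ∧ h' ≫ U.ι = h := by
  let U : E.Opens := ⟨Set.range h, h.isOpenMap.isOpen_range⟩
  refine ⟨U, IsOpenImmersion.lift U.ι h (by simp [U]), ⟨fun y ↦ ?_⟩,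
    IsOpenImmersion.lift_fac _ _ _⟩
  obtain ⟨t, ht⟩ := y.2
  refine ⟨t, U.ι.isOpenEmbedding.injective ?_⟩
  rw [← Scheme.Hom.comp_apply, IsOpenImmersion.lift_fac]
  exact ht

end Morphisms

/-! ### Construction of the universal factorization -/

variable {T S : Scheme.{u}} {f : T ⟶ S}

/-- Every morphism to an étale separated `S`-scheme factors through a surjective one. -/
lemma exists_factorisation [UniversallyOpen f] {E : Scheme.{u}} (h : T ⟶ E) (g : E ⟶ S)
    (hg : IsEtaleSeparated g) (hf : h ≫ g = f) :
    ∃ (F : SepEtaleFactorisation f) (j : F.obj.mid ⟶ E),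
      F.obj.ι ≫ j = h ∧ j ≫ g = F.obj.π := by
  obtain ⟨_, _⟩ := hg
  have : UniversallyOpen (h ≫ g) := hf ▸ ‹_›
  have : UniversallyOpen h := universallyOpen_of_comp h g
  obtain ⟨U, h', hs, hU⟩ := exists_surjective_open_factor h
  exact ⟨⟨⟨U, h', U.ι ≫ g, by rw [reassoc_of% hU, hf]⟩, hs, ⟨inferInstance, inferInstance⟩⟩,
    U.ι, hU, rfl⟩

lemma noetherianSpace_fiber {X : Scheme.{u}} (p : X ⟶ S) [LocallyOfFiniteType p]
    [QuasiCompact p] (s : S) : TopologicalSpace.NoetherianSpace (p.fiber s) := by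
  have : LocallyOfFiniteType (p.fiberToSpecResidueField s) :=
    inferInstanceAs (LocallyOfFiniteType (pullback.snd _ _))
  have : IsLocallyNoetherian (p.fiber s) :=
    LocallyOfFiniteType.isLocallyNoetherian (p.fiberToSpecResidueField s)
  have : IsNoetherian (p.fiber s) := {}
  infer_instance

/-- A factorization which maps, uniquely, to every étale separated `S`-scheme under `T`. -/
lemma exists_universal_factorisation [IrreducibleSpace S] [UniversallyOpen f]
    [LocallyOfFiniteType f] [QuasiCompact f] :
    ∃ F : SepEtaleFactorisation f, ∀ (E : Scheme.{u}) (h : T ⟶ E) (g : E ⟶ S),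
      IsEtaleSeparated g → h ≫ g = f → ∃! u : F.obj.mid ⟶ E, F.obj.ι ≫ u = h ∧ u ≫ g = F.obj.π := by
  let p := pullback.fst f f ≫ f
  have := noetherianSpace_fiber p (genericPoint S)
  let Z (F : SepEtaleFactorisation f) :
      TopologicalSpace.Closeds (p.fiber (genericPoint S)) :=
    have := F.property.2.2
    ⟨p.fiberι _ ⁻¹' coincidence F.obj,
      (isClosed_coincidence F.obj).preimage (p.fiberι _).continuous⟩
  -- The open image of `T` in `S` shows that factorizations exist.
  obtain ⟨F₀, -⟩ := exists_factorisation (f := f) f (𝟙 S)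
    ⟨inferInstance, inferInstance⟩ (Category.comp_id f)
  obtain ⟨_, ⟨F, rfl⟩, hF⟩ := (wellFounded_lt
    (α := TopologicalSpace.Closeds (p.fiber (genericPoint S)))).has_min (Set.range Z) ⟨_, F₀, rfl⟩
  obtain ⟨_, _, _⟩ := F.property
  refine ⟨F, fun E h g hg hf ↦ existsUnique_of_exists_of_unique ?_ fun u v hu hv ↦ ?_⟩
  · obtain ⟨_, _⟩ := hg
    -- `G` refines `F` and also maps to `E`; inverting `G ⟶ F` will give the required map.
    obtain ⟨G, j, hj, hjπ⟩ := exists_factorisation (f := f)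
      (pullback.lift F.obj.ι h (F.obj.ι_π.trans hf.symm)) (pullback.fst F.obj.π g ≫ F.obj.π)
      ⟨inferInstance, inferInstance⟩
      (by rw [pullback.lift_fst_assoc, F.obj.ι_π])
    obtain ⟨_, _, _⟩ := G.property
    let u : G.obj ⟶ F.obj :=
      { h := j ≫ pullback.fst _ _
        ι_h := by rw [reassoc_of% hj, pullback.lift_fst]
        h_π := by rw [Category.assoc, hjπ] }
    have hle : Z G ≤ Z F := fun x hx ↦ coincidence_mono u hx
    have heq : Z G = Z F := hle.eq_of_not_lt (hF _ ⟨G, rfl⟩)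
    have hu : IsIso u.h := by
      refine isIso_of_coincidence_subset u fun x hx hxF ↦ ?_
      obtain ⟨y, rfl⟩ : x ∈ Set.range (p.fiberι (genericPoint S)) := by
        rw [Scheme.Hom.range_fiberι]
        exact hx
      have hy : y ∈ Z F := hxF
      rw [← heq] at hy
      exact hy
    refine ⟨inv u.h ≫ j ≫ pullback.snd _ _, ?_, ?_⟩
    · have : F.obj.ι ≫ inv u.h = G.obj.ι := by
        rw [IsIso.comp_inv_eq, u.ι_h]
      rw [reassoc_of% this, reassoc_of% hj, pullback.lift_snd]
    · rw [Category.assoc, Category.assoc, ← pullback.condition, hjπ, ← u.h_π,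
        IsIso.inv_hom_id_assoc]
  · have := hg.1
    exact hom_ext_of_surjective F.obj.ι hu.2 hv.2 (hu.1.trans hv.1.symm)

/-- A factorization mapping uniquely to every étale separated `S`-scheme is initial. -/
lemma nonempty_isInitial (F : SepEtaleFactorisation f)
    (hF : ∀ (E : Scheme.{u}) (h : T ⟶ E) (g : E ⟶ S), IsEtaleSeparated g → h ≫ g = f →
      ∃! u : F.obj.mid ⟶ E, F.obj.ι ≫ u = h ∧ u ≫ g = F.obj.π) :
    Nonempty (IsInitial F) := by
  refine ⟨IsInitial.ofUniqueHom (fun G ↦ ⟨⟨_, (hF _ G.obj.ι G.obj.π G.property.2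
    G.obj.ι_π).choose_spec.1.1, (hF _ G.obj.ι G.obj.π G.property.2
    G.obj.ι_π).choose_spec.1.2⟩⟩) fun G m ↦ ?_⟩
  refine ObjectProperty.hom_ext _ (Factorisation.Hom.ext ?_)
  exact (hF _ G.obj.ι G.obj.π G.property.2 G.obj.ι_π).choose_spec.2 _ ⟨m.hom.ι_h, m.hom.h_π⟩

lemma exists_universal_hom [IrreducibleSpace S] (T : Over S) (hT : flatFP S T) :
    ∃ (E : Over S) (h : T ⟶ E), etaleSeparated S E ∧ IsInitialFactorisation h ∧
      IsUniversalToEtaleSeparated h := by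
  obtain ⟨_, _, _, _⟩ := hT
  obtain ⟨F, hF⟩ := exists_universal_factorisation (f := T.hom)
  refine ⟨Over.mk F.obj.π, Over.homMk F.obj.ι F.obj.ι_π, F.property.2,
    ⟨F.property, nonempty_isInitial F hF⟩, fun E' hE' φ ↦ ?_⟩
  obtain ⟨u, ⟨hu, huπ⟩, huniq⟩ := hF E'.left φ.left E'.hom hE' (Over.w φ)
  refine ⟨Over.homMk u huπ, Over.OverMorphism.ext hu, fun v hv ↦ Over.OverMorphism.ext ?_⟩
  exact huniq v.left ⟨congr($(hv).left), Over.w v⟩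

/-- Only quasi-compactness of `E` has to come from `T`, through the surjection; étaleness and
separatedness give the rest. -/
lemma flatFP_of_isInitialFactorisation {T E : Over S} (h : T ⟶ E)
    (hh : IsInitialFactorisation h) (hT : flatFP S T) : flatFP S E := by
  obtain ⟨_, _, _, _⟩ := hT
  obtain ⟨⟨hs, _, _⟩, -⟩ := hh
  have : Etale E.hom := ‹Etale (factorisationOfHom h).π›
  have : IsSeparated E.hom := ‹IsSeparated (factorisationOfHom h).π›
  have : Surjective h.left := hs
  have : QuasiCompact (h.left ≫ E.hom) := by rwa [Over.w]
  exact ⟨inferInstance, inferInstance, quasiCompact_of_comp_surjective h.left E.hom, inferInstance⟩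

lemma faithfullyFlatFP_of_isInitialFactorisation {T E : Over S} (h : T ⟶ E)
    (hh : IsInitialFactorisation h) (hT : faithfullyFlatFP S T) : faithfullyFlatFP S E := by
  have hE := flatFP_of_isInitialFactorisation h hh ⟨hT.1, hT.2.2⟩
  have : Surjective (h.left ≫ E.hom) := by
    rw [Over.w]
    exact hT.2.1
  exact ⟨hE.1, .of_comp h.left E.hom, hE.2⟩

/-- Universal morphisms to étale separated `S`-schemes assemble into a left adjoint of the
inclusion, as soon as their targets stay in the given full subcategory. -/
lemma exists_adjunction [IrreducibleSpace S] (P : ObjectProperty (Over S)) (hP : P ≤ flatFP S)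
    (hPE : ∀ {T E : Over S} (h : T ⟶ E), IsInitialFactorisation h → P T → P E) :
    ∃ (πs : P.FullSubcategory ⥤ (etaleSeparated S ⊓ P).FullSubcategory)
      (adj : πs ⊣ inclusion P), ∀ T : P.FullSubcategory,
        IsInitialFactorisation (adj.unit.app T).hom ∧
        IsUniversalToEtaleSeparated (adj.unit.app T).hom := by
  choose E h hE hinit huniv using fun T : P.FullSubcategory ↦
    exists_universal_hom T.obj (hP _ T.property)
  let L (T : P.FullSubcategory) : (etaleSeparated S ⊓ P).FullSubcategory :=
    ⟨E T, hE T, hPE (h T) (hinit T) T.property⟩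
  let e (T : P.FullSubcategory) (X : (etaleSeparated S ⊓ P).FullSubcategory) :
      (L T ⟶ X) ≃ (T ⟶ (inclusion P).obj X) :=
    Equiv.ofBijective (fun ψ ↦ ⟨h T ≫ ψ.hom⟩) <| by
      refine ⟨fun a b hab ↦ ObjectProperty.hom_ext _ ?_, fun φ ↦ ?_⟩
      · exact (huniv T X.obj X.property.1 _).unique rfl congr($(hab.symm).hom)
      · obtain ⟨ψ, hψ, -⟩ := huniv T X.obj X.property.1 φ.hom
        exact ⟨⟨ψ⟩, ObjectProperty.hom_ext _ hψ⟩
  have he : ∀ T X X' g k, e T X' (k ≫ g) = e T X k ≫ (inclusion P).map g := fun T X X' g k ↦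
    ObjectProperty.hom_ext _ (Category.assoc _ _ _).symm
  refine ⟨_, Adjunction.adjunctionOfEquivLeft e he, fun T ↦ ?_⟩
  -- The unit corresponds to the identity under `e`, which is composition with `h T`.
  have hunit : ((Adjunction.adjunctionOfEquivLeft e he).unit.app T).hom = h T := by
    rw [← Adjunction.homEquiv_id]
    exact Category.comp_id (h T)
  rw [hunit]
  exact ⟨hinit T, huniv T⟩

end SepEtale

theorem mainTheorem10 (S : Scheme.{u}) [IsIntegral S] :
    (∀ (T : Scheme.{u}) (f : T ⟶ S), Flat f → Surjective f → SepEtale.IsFinitelyPresented f →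
      HasInitial (SepEtale.SepEtaleFactorisation f)) ∧
    (∃ (πs : (SepEtale.faithfullyFlatFP S).FullSubcategory ⥤
          (SepEtale.etaleSeparated S ⊓ SepEtale.faithfullyFlatFP S).FullSubcategory)
        (adj : πs ⊣ SepEtale.inclusion (SepEtale.faithfullyFlatFP S)),
        ∀ T : (SepEtale.faithfullyFlatFP S).FullSubcategory,
          SepEtale.IsInitialFactorisation (adj.unit.app T).hom ∧
          SepEtale.IsUniversalToEtaleSeparated (adj.unit.app T).hom) ∧
    (∃ (πs : (SepEtale.flatFP S).FullSubcategory ⥤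
          (SepEtale.etaleSeparated S ⊓ SepEtale.flatFP S).FullSubcategory)
        (adj : πs ⊣ SepEtale.inclusion (SepEtale.flatFP S)),
        ∀ T : (SepEtale.flatFP S).FullSubcategory,
          SepEtale.IsInitialFactorisation (adj.unit.app T).hom ∧
          SepEtale.IsUniversalToEtaleSeparated (adj.unit.app T).hom) := by
  refine ⟨fun T f _ _ hf ↦ ?_, SepEtale.exists_adjunction _ (fun T hT ↦ ⟨hT.1, hT.2.2⟩)
      SepEtale.faithfullyFlatFP_of_isInitialFactorisation,
    SepEtale.exists_adjunction _ le_rfl SepEtale.flatFP_of_isInitialFactorisation⟩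
  obtain ⟨_, _, _⟩ := hf
  obtain ⟨F, hF⟩ := SepEtale.exists_universal_factorisation (f := f)
  exact (SepEtale.nonempty_isInitial F hF).some.hasInitial
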